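/- Let $\alpha\in(0,2)$, $D=(-1,1)$ and $$c_\alpha=\frac{2^\alpha\,\Gamma(\frac{1+\alpha}{2})}{\sqrt\pi\,|\Gamma(-\frac{\alpha}{2})|}.$$ Let $\mathcal A=(-d^2/dx^2)^{\alpha/2}$ be the fractional Laplace operator, $$\mathcal A f(x)=c_\alpha\,\mathrm{p.v.}\!\int_{-\infty}^{\infty}\frac{f(x)-f(y)}{|x-y|^{1+\alpha}}\,dy ,$$ and let $\mathcal A_D$ be this operator on $D$ with zero exterior condition, that is, the self-adjoint operator on $L^2(D)$ which is the Friedrichs extension of $f\mapsto(\mathcal A f)|_D$, $f\in C_c^\infty(D)$. Let $\lambda_1\le\lambda_2\le\dots$ be the eigenvalues of $\mathcal A_D$, counted with multiplicity. Let $N\ge 1$ be an integer, $\varepsilon=2/N$, let $\zeta$ be the Riemann zeta function, and let $V$ be the $N\times N$ Toeplitz matrix with entries $$V_{p,q}=-\frac{c_\alpha}{\varepsilon^{\alpha}}\,\frac{1}{(|p-q|+1)^{1+\alpha}}\quad(p\ne q),\qquad V_{p,p}=\frac{2c_\alpha(\zeta(1+\alpha)-1)}{\varepsilon^{\alpha}}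 ,\qquad p,q=1,\dots,N.$$ For $n\ge1$ let $\lambda_{n,\varepsilon}$ be the $n$-th smallest eigenvalue of $V$ (counted with multiplicity) if $n\le N$, and $\lambda_{n,\varepsilon}=c_\alpha\varepsilon^{-\alpha}(2\zeta(1+\alpha)-1)$ if $n>N$. Then $$\lambda_n\ge\lambda_{n,\varepsilon}\qquad\text{for all } n\ge1 .$$ -/

import Mathlib

open MeasureTheory Filter Set
open scoped Topology ContDiff

namespace FracInterval

/-- The interval `D = (-1, 1)`. -/
abbrev D : Set ℝ := Ioo (-1 : ℝ) 1

/-- The real Hilbert space `L²(D)`. -/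
abbrev L2D : Type := Lp ℝ 2 (volume.restrict D)

/-- The constant `c_α = 2^α Γ((1+α)/2) / (√π |Γ(-α/2)|)`. -/
noncomputable def c (α : ℝ) : ℝ :=
  (2 : ℝ) ^ α * Real.Gamma ((1 + α) / 2) / (Real.sqrt Real.pi * |Real.Gamma (-α / 2)|)

/-- The fractional Laplace operator `(-d²/dx²)^{α/2}`, defined pointwise by the principal value
integral `c_α p.v. ∫ (f x - f y) / |x - y|^{1+α} dy`. The limit exists at every point whenever `f`
is smooth and bounded; it is applied below to test functions only. -/
noncomputable def fracLap (α : ℝ) (f : ℝ → ℝ) (x : ℝ) : ℝ :=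
  c α * limUnder (𝓝[>] (0 : ℝ))
    (fun δ : ℝ => ∫ y in {y : ℝ | δ < |x - y|}, (f x - f y) / |x - y| ^ (1 + α))

/-- `φ ∈ C_c^∞(D)`, as a function on `ℝ` (equal to `0` outside `D`). -/
def IsTest (φ : ℝ → ℝ) : Prop :=
  ContDiff ℝ ∞ φ ∧ HasCompactSupport φ ∧ tsupport φ ⊆ D

/-- The quadratic form `⟨A φ, φ⟩` in `L²(D)`, used for `φ ∈ C_c^∞(D)`. -/
noncomputable def energy (α : ℝ) (φ : ℝ → ℝ) : ℝ :=
  ∫ x in D, fracLap α φ x * φ x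

/-- `f` lies in the form domain of the fractional Laplace operator on `D` with zero exterior
condition: the closure of `C_c^∞(D)` in the form norm, that is, `f` is the `L²(D)` limit of a
sequence of test functions that is Cauchy for the quadratic form `⟨A φ, φ⟩`. -/
def InFormDomain (α : ℝ) (f : L2D) : Prop :=
  ∃ φ : ℕ → ℝ → ℝ, (∀ k, IsTest (φ k)) ∧
    Tendsto (fun k => eLpNorm (fun x => φ k x - f x) 2 (volume.restrict D)) atTop (𝓝 0) ∧
    ∀ δ : ℝ, 0 < δ → ∃ K : ℕ, ∀ j ≥ K, ∀ k ≥ K, energy α (fun x => φ j x - φ k x) < δ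

/-- The graph of the self-adjoint operator `A_D` on `L²(D)`: `IsAD α f g` says that `f` is in the
domain of `A_D` and `A_D f = g`. Here `A_D` is the Friedrichs extension of the operator
`φ ↦ (A φ)|_D`, `φ ∈ C_c^∞(D)` (equivalently, `-A_D` is the generator of the symmetric `α`-stable
process killed upon leaving `D`): the adjoint of that operator, restricted to the form domain. -/
def IsAD (α : ℝ) (f g : L2D) : Prop :=
  InFormDomain α f ∧
    ∀ ψ : ℝ → ℝ, IsTest ψ → ∫ x in D, f x * fracLap α ψ x = ∫ x in D, g x * ψ x

/-- `lam α n` is `λ_n` (`n = 1, 2, …`), the `n`-th smallest eigenvalue of `A_D`, counted with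
multiplicity: the least `t` for which there are `n` linearly independent eigenfunctions of `A_D`
with eigenvalues not greater than `t`. (With the convention `inf ∅ = ∞`.) -/
noncomputable def lam (α : ℝ) (n : ℕ) : EReal :=
  sInf ((fun t : ℝ => (t : EReal)) ''
    {t : ℝ | ∃ (φ : Fin n → L2D) (μ : Fin n → ℝ), LinearIndependent ℝ φ ∧
      ∀ i, IsAD α (φ i) (μ i • φ i) ∧ μ i ≤ t})

/-- `ζ(1 + α)` as a real number, `ζ` being the Riemann zeta function. -/
noncomputable def zetaOnePlus (α : ℝ) : ℝ := (riemannZeta (1 + (α : ℂ))).re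

/-- The `N × N` Toeplitz matrix `V`, with `ε = 2 / N`. -/
noncomputable def V (α : ℝ) (N : ℕ) : Matrix (Fin N) (Fin N) ℝ :=
  Matrix.of fun p q =>
    if p = q then 2 * c α * (zetaOnePlus α - 1) / (2 / (N : ℝ)) ^ α
    else -(c α / (2 / (N : ℝ)) ^ α) * (1 / (|((p : ℕ) : ℝ) - ((q : ℕ) : ℝ)| + 1) ^ (1 + α))

theorem V_isHermitian (α : ℝ) (N : ℕ) : (V α N).IsHermitian := by
  ext p q
  simp only [V, Matrix.conjTranspose_apply, Matrix.of_apply, star_trivial, eq_comm (a := q),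
    abs_sub_comm ((q : ℕ) : ℝ)]

/-- `λ_{n,ε}` for `ε = 2 / N`, `n = 1, 2, …`: the `n`-th smallest eigenvalue of `V` when `n ≤ N`
(Mathlib's `eigenvalues₀` lists the eigenvalues with multiplicity in decreasing order, from index
`0`), and `c_α ε^{-α} (2 ζ(1+α) - 1)` when `n > N`. -/
noncomputable def lamEps (α : ℝ) (N n : ℕ) : ℝ :=
  if h : 1 ≤ n ∧ n ≤ N then
    (V_isHermitian α N).eigenvalues₀ ⟨N - n, by rw [Fintype.card_fin]; omega⟩
  else c α * (2 / (N : ℝ)) ^ (-α) * (2 * zetaOnePlus α - 1)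

end FracInterval

/-!
Let `E` be the quadratic form of the fractional Laplace operator on `C_c^∞(D)`. Symmetrizing the
principal value integral and applying Fubini's theorem once (`IsTest.integral_fracLap_mul`) gives
`E(φ) = (c_α / 2) ∬ (φ x - φ y)² |x - y|^{-1-α} dx dy`. Divide the line into cells of length
`ε = 2 / N`, so that `D` consists of `N` of them up to an end point. Points `x`, `y` of the cells
`p`, `q` satisfy `|x - y| ≤ ε (|p - q| + 1)`, so that `E` decreases when its kernel is replaced by
the bounded kernel `(ε (|p - q| + 1))^{-1-α}`. The integral of the new kernel in `y` over the line
is `ε^{-α} (2 ζ(1+α) - 1)` for every `x`; expanding the square one obtains (`discreteForm_toL2_le`)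

  `E(φ) ≥ M (‖φ‖² - |a|²) + ⟨V a, a⟩`,  `M = c_α ε^{-α} (2 ζ(1+α) - 1)`,

where `a ∈ ℝ^N` are the coordinates of `φ` with respect to the normalized indicators of the cells.

The right-hand side is continuous in `L²(D)`, so this lower bound extends to the domain of the
Friedrichs extension (`le_inner_of_mem_friedrichs`). On the span of eigenfunctions of `A_D` with
eigenvalues at most `t` the form is at most `t ‖f‖²` (`inner_sum_eigenvectors_le`). The spectrum of
the right-hand side consists of the eigenvalues of `V` and of `M`. By Pólya's criterion the Toeplitz
matrix with entries `(|p - q| + 1)^{-1-α}` is positive semidefinite (`sum_toeplitz_nonneg`), so that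
no eigenvalue of `V` exceeds `M`, and the min-max principle gives the result
(`lamEps_le_of_discreteForm_le`).
-/

namespace FracInterval

/-! ### Test functions -/

namespace IsTest

variable {φ ψ : ℝ → ℝ}

theorem continuous (h : IsTest φ) : Continuous φ := h.1.continuous

theorem eq_zero (h : IsTest φ) {x : ℝ} (hx : x ∉ D) : φ x = 0 :=
  image_eq_zero_of_notMem_tsupport fun hx' => hx (h.2.2 hx')

theorem add (h : IsTest φ) (h' : IsTest ψ) : IsTest (φ + ψ) :=
  ⟨h.1.add h'.1, h.2.1.add h'.2.1,
    (tsupport_add φ ψ).trans (union_subset h.2.2 h'.2.2)⟩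

theorem smul (r : ℝ) (h : IsTest φ) : IsTest (r • φ) :=
  ⟨contDiff_const.smul h.1, h.2.1.smul_left (f := fun _ => r),
    (tsupport_smul_subset_right (fun _ => r) φ).trans h.2.2⟩

theorem zero : IsTest (0 : ℝ → ℝ) :=
  ⟨contDiff_const, HasCompactSupport.zero, by simp [tsupport]⟩

theorem integrable (h : IsTest φ) : Integrable φ :=
  h.continuous.integrable_of_hasCompactSupport h.2.1

theorem exists_bound (h : IsTest φ) : ∃ B, ∀ x, |φ x| ≤ B :=
  h.2.1.exists_bound_of_continuous h.continuous

theorem integral_D (h : IsTest φ) (g : ℝ → ℝ) : ∫ x in D, g x * φ x = ∫ x, g x * φ x :=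
  setIntegral_eq_integral_of_forall_compl_eq_zero fun x hx => by simp [h.eq_zero hx]

/-- Second differences of a test function are of second order in the step. This is what makes the
principal value integral converge for all `α < 2`. -/
theorem exists_secondDiff_bound (h : IsTest φ) :
    ∃ C, ∀ x t, |2 * φ x - φ (x + t) - φ (x - t)| ≤ C * min 1 (t ^ 2) := by
  obtain ⟨B, hB⟩ := h.exists_bound
  have hd1 : ContDiff ℝ 1 (deriv φ) := by
    have : ContDiff ℝ (1 + 1) φ := by
      simpa only [Nat.cast_ofNat, one_add_one_eq_two] using contDiff_infty.1 h.1 2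
    exact (contDiff_succ_iff_deriv.1 this).2.2
  have hdiff : Differentiable ℝ φ := h.1.differentiable (by simp)
  obtain ⟨B', hB'⟩ :=
    (h.2.1.deriv (𝕜 := ℝ)).deriv (𝕜 := ℝ) |>.exists_bound_of_continuous
      (hd1.continuous_deriv (by simp))
  have hlip : ∀ a b, |deriv φ b - deriv φ a| ≤ B' * |b - a| := fun a b => by
    simpa using Convex.norm_image_sub_le_of_norm_deriv_le (s := univ) (f := deriv φ)
      (fun x _ => hd1.differentiable (by simp) x) (fun x _ => hB' x) convex_univ
      (mem_univ a) (mem_univ b)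
  have hB0 : 0 ≤ B := (abs_nonneg _).trans (hB 0)
  have hB'0 : 0 ≤ B' := (norm_nonneg _).trans (hB' 0)
  refine ⟨4 * B + 2 * B', fun x t => ?_⟩
  have h1 : |2 * φ x - φ (x + t) - φ (x - t)| ≤ 4 * B := by
    have := hB x; have := hB (x + t); have := hB (x - t)
    rw [abs_le] at *; constructor <;> linarith
  have h2 : |2 * φ x - φ (x + t) - φ (x - t)| ≤ 2 * B' * t ^ 2 := by
    have key := Convex.norm_image_sub_le_of_norm_hasDerivWithin_le (s := uIcc 0 t)
      (f := fun s => 2 * φ x - φ (x + s) - φ (x - s))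
      (f' := fun s => - deriv φ (x + s) + deriv φ (x - s)) (C := 2 * B' * |t|)
      (fun s _ => by
        have e1 : HasDerivAt (fun s => φ (x + s)) (deriv φ (x + s)) s :=
          (hdiff (x + s)).hasDerivAt.comp_const_add x s
        have e2 : HasDerivAt (fun s => φ (x - s)) (-deriv φ (x - s)) s :=
          (hdiff (x - s)).hasDerivAt.comp_const_sub x s
        have := ((hasDerivAt_const s (2 * φ x)).sub e1).sub e2
        exact (this.congr_deriv (by ring)).hasDerivWithinAt)
      (fun s hs => by
        have hs' : |s| ≤ |t| := by
          have := abs_sub_left_of_mem_uIcc hs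
          simpa using this
        have := hlip (x + s) (x - s)
        rw [Real.norm_eq_abs, show -deriv φ (x + s) + deriv φ (x - s)
          = deriv φ (x - s) - deriv φ (x + s) by ring]
        refine this.trans ?_
        rw [show x - s - (x + s) = -(2 * s) by ring, abs_neg, abs_mul, abs_two]
        nlinarith)
      (convex_uIcc 0 t) left_mem_uIcc right_mem_uIcc
    simp only [add_zero, sub_zero, Real.norm_eq_abs] at key
    rw [show 2 * φ x - φ (x + t) - φ (x - t) - (2 * φ x - φ x - φ x)
      = 2 * φ x - φ (x + t) - φ (x - t) by ring] at key
    calc _ ≤ _ := key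
      _ = 2 * B' * (|t| * |t|) := by ring
      _ = _ := by rw [abs_mul_abs_self]; ring
  rcases min_cases 1 (t ^ 2) with ⟨e, _⟩ | ⟨e, _⟩ <;> rw [e]
  · linarith
  · nlinarith [sq_nonneg t]

end IsTest

/-! ### The principal value integral -/

theorem integrable_min_mul_kernel {α : ℝ} (hα0 : 0 < α) (hα2 : α < 2) :
    Integrable fun h : ℝ => min 1 (h ^ 2) * (1 / |h| ^ (1 + α)) := by
  set f : ℝ → ℝ := fun h => min 1 (h ^ 2) * (1 / |h| ^ (1 + α)) with hf
  have hpos : IntegrableOn f (Ioi 0) := by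
    rw [← Ioc_union_Ioi_eq_Ioi zero_le_one]
    refine IntegrableOn.union ?_ ?_
    · have h1 : IntegrableOn (fun h : ℝ => h ^ (1 - α)) (Ioc 0 1) :=
        (intervalIntegral.intervalIntegrable_rpow' (by linarith)).1
      refine h1.congr_fun (fun h hh => ?_) measurableSet_Ioc
      have h0 : 0 < h := hh.1
      have : h ^ 2 ≤ 1 := by nlinarith [hh.2]
      simp only [hf]
      rw [min_eq_right this, abs_of_pos h0, ← Real.rpow_natCast, mul_one_div,
        ← Real.rpow_sub h0]
      congr 1; push_cast; ring
    · have h1 : IntegrableOn (fun h : ℝ => h ^ (-(1 + α))) (Ioi 1) :=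
        integrableOn_Ioi_rpow_of_lt (by linarith) one_pos
      refine h1.congr_fun (fun h hh => ?_) measurableSet_Ioi
      have hh' : 1 < h := hh
      have h0 : 0 < h := by linarith
      have : 1 ≤ h ^ 2 := by nlinarith
      simp only [hf]
      rw [min_eq_left this, abs_of_pos h0, Real.rpow_neg h0.le, one_mul, one_div]
  have hneg : IntegrableOn f (Iio 0) := by
    have := ((Measure.measurePreserving_neg (volume : Measure ℝ)).integrableOn_comp_preimage
      (MeasurableEquiv.neg ℝ).measurableEmbedding (s := Ioi 0)).2 hpos
    have e : f ∘ Neg.neg = f := by ext h; simp [hf]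
    rw [e] at this
    simpa using this
  rw [← integrableOn_univ, ← Iic_union_Ioi (a := (0 : ℝ))]
  exact ((integrableOn_Iic_iff_integrableOn_Iio (by simp)).2 hneg).union hpos

variable {α : ℝ} {φ ψ : ℝ → ℝ}

theorem measurable_kernel (α : ℝ) : Measurable fun h : ℝ => 1 / |h| ^ (1 + α) := by fun_prop

theorem kernel_nonneg (α h : ℝ) : 0 ≤ 1 / |h| ^ (1 + α) := by positivity

theorem IsTest.integrable_secondDiff_mul_kernel (hα0 : 0 < α) (hα2 : α < 2) (hφ : IsTest φ)
    (x : ℝ) :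
    Integrable fun h => (2 * φ x - φ (x + h) - φ (x - h)) * (1 / |h| ^ (1 + α)) := by
  obtain ⟨C, hC⟩ := hφ.exists_secondDiff_bound
  have hc := hφ.continuous
  refine ((integrable_min_mul_kernel hα0 hα2).const_mul C).mono'
    ((by fun_prop : Measurable _).aestronglyMeasurable) (ae_of_all _ fun h => ?_)
  rw [norm_mul, Real.norm_of_nonneg (kernel_nonneg α h), ← mul_assoc]
  exact mul_le_mul_of_nonneg_right (hC x h) (kernel_nonneg α h)

/-- The truncated singular integral, symmetrized under `h ↦ -h`. -/
theorem IsTest.truncated_eq (hα0 : 0 < α) (hα2 : α < 2) (hφ : IsTest φ)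
    (x : ℝ) {δ : ℝ} (hδ : 0 < δ) :
    ∫ y in {y : ℝ | δ < |x - y|}, (φ x - φ y) / |x - y| ^ (1 + α) =
      1 / 2 * ∫ h in {h : ℝ | δ < |h|},
        (2 * φ x - φ (x + h) - φ (x - h)) * (1 / |h| ^ (1 + α)) := by
  have hc := hφ.continuous
  obtain ⟨B, hB⟩ := hφ.exists_bound
  have hS : MeasurableSet {h : ℝ | δ < |h|} := measurableSet_lt measurable_const (by fun_prop)
  have hker : IntegrableOn (fun h : ℝ => 1 / |h| ^ (1 + α)) {h : ℝ | δ < |h|} := by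
    have hm : 0 < min 1 (δ ^ 2) := lt_min one_pos (by positivity)
    refine (((integrable_min_mul_kernel hα0 hα2).const_mul (min 1 (δ ^ 2))⁻¹).integrableOn).mono'
      (measurable_kernel α).aestronglyMeasurable ?_
    filter_upwards [ae_restrict_mem hS] with h hh
    rw [Real.norm_of_nonneg (kernel_nonneg α h), ← mul_assoc]
    refine le_mul_of_one_le_left (kernel_nonneg α h) ?_
    rw [inv_mul_eq_div, one_le_div hm]
    refine min_le_min le_rfl ?_
    rw [← sq_abs h]
    exact pow_le_pow_left₀ hδ.le (le_of_lt hh) 2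
  have hint : ∀ s : ℝ → ℝ, Continuous s → IntegrableOn
      (fun h : ℝ => (φ x - φ (s h)) * (1 / |h| ^ (1 + α))) {h : ℝ | δ < |h|} := fun s hs => by
    refine (Integrable.const_mul hker (2 * B)).mono'
      (by fun_prop : Measurable _).aestronglyMeasurable (ae_of_all _ fun h => ?_)
    rw [norm_mul, Real.norm_of_nonneg (kernel_nonneg α h)]
    refine mul_le_mul_of_nonneg_right ?_ (kernel_nonneg α h)
    have := hB x; have := hB (s h)
    rw [Real.norm_eq_abs, abs_le] at *; constructor <;> linarith
  have e1 : ∫ y in {y : ℝ | δ < |x - y|}, (φ x - φ y) / |x - y| ^ (1 + α) =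
      ∫ h in {h : ℝ | δ < |h|}, (φ x - φ (x + h)) * (1 / |h| ^ (1 + α)) := by
    have := (measurePreserving_add_left volume x).setIntegral_preimage_emb
      (measurableEmbedding_addLeft x) (fun y => (φ x - φ y) / |x - y| ^ (1 + α))
      {y : ℝ | δ < |x - y|}
    rw [← this]
    simp [div_eq_mul_inv]
  have e2 : ∫ y in {y : ℝ | δ < |x - y|}, (φ x - φ y) / |x - y| ^ (1 + α) =
      ∫ h in {h : ℝ | δ < |h|}, (φ x - φ (x - h)) * (1 / |h| ^ (1 + α)) := by
    have := (Measure.measurePreserving_sub_left volume x).setIntegral_preimage_emb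
      (MeasurableEquiv.subLeft x).measurableEmbedding
      (fun y => (φ x - φ y) / |x - y| ^ (1 + α)) {y : ℝ | δ < |x - y|}
    rw [← this]
    simp [div_eq_mul_inv]
  have e3 := integral_add (hint (fun h => x + h) (by fun_prop))
    (hint (fun h => x - h) (by fun_prop))
  rw [← e1, ← e2] at e3
  rw [show ∀ a b : ℝ, a = 1 / 2 * b ↔ b = a + a from
      fun a b => by constructor <;> intro h <;> linarith,
    ← e3]
  congr 1; ext h; ring

theorem IsTest.fracLap_eq (hα0 : 0 < α) (hα2 : α < 2) (hφ : IsTest φ) (x : ℝ) :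
    fracLap α φ x =
      c α / 2 * ∫ h, (2 * φ x - φ (x + h) - φ (x - h)) * (1 / |h| ^ (1 + α)) := by
  have hI := hφ.integrable_secondDiff_mul_kernel hα0 hα2 x
  set F : ℝ → ℝ := fun h => (2 * φ x - φ (x + h) - φ (x - h)) * (1 / |h| ^ (1 + α)) with hF
  have hF0 : F 0 = 0 := by simp only [hF, add_zero, sub_zero]; ring
  have hlim : Tendsto (fun δ : ℝ => ∫ h in {h : ℝ | δ < |h|}, F h) (𝓝[>] 0) (𝓝 (∫ h, F h)) := by
    have hS : ∀ δ : ℝ, MeasurableSet {h : ℝ | δ < |h|} := fun δ =>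
      measurableSet_lt measurable_const (by fun_prop)
    simp_rw [← integral_indicator (hS _)]
    refine tendsto_integral_filter_of_dominated_convergence (fun h => ‖F h‖)
      (Eventually.of_forall fun δ => (hI.indicator (hS δ)).aestronglyMeasurable)
      (Eventually.of_forall fun δ => ae_of_all _ fun h => norm_indicator_le_norm_self _ _)
      hI.norm (ae_of_all _ fun h => ?_)
    refine tendsto_const_nhds.congr' ?_
    rcases eq_or_ne h 0 with rfl | h0
    · exact Eventually.of_forall fun δ => by simp [indicator, hF0]
    · filter_upwards [nhdsWithin_le_nhds (Iio_mem_nhds (abs_pos.2 h0))] with δ hδ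
      rw [indicator_of_mem (show h ∈ {h : ℝ | δ < |h|} from hδ)]
  rw [fracLap, Tendsto.limUnder_eq (x := 1 / 2 * ∫ h, F h)]
  · ring
  · refine (hlim.const_mul (1 / 2)).congr' ?_
    filter_upwards [self_mem_nhdsWithin] with δ hδ
    exact (hφ.truncated_eq hα0 hα2 x hδ).symm

/-! ### The quadratic form -/

section form

variable {α : ℝ} {φ ψ : ℝ → ℝ}

theorem IsTest.integrable_mul (hφ : IsTest φ) (hψ : IsTest ψ) (a b : ℝ) :
    Integrable fun x => φ (x + a) * ψ (x + b) := by
  obtain ⟨B, hB⟩ := hφ.exists_bound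
  have hc := hφ.continuous
  exact (hψ.integrable.comp_add_right b).bdd_mul
    (by fun_prop : Continuous fun x => φ (x + a)).aestronglyMeasurable
    (ae_of_all _ fun x => hB (x + a))

theorem IsTest.integral_secondDiff_mul (hφ : IsTest φ) (hψ : IsTest ψ) (h : ℝ) :
    ∫ x, (2 * φ x - φ (x + h) - φ (x - h)) * ψ x =
      ∫ x, (φ (x + h) - φ x) * (ψ (x + h) - ψ x) := by
  have i1 : Integrable fun x => φ x * ψ x := by simpa using hφ.integrable_mul hψ 0 0
  have i2 : Integrable fun x => φ (x + h) * ψ x := by simpa using hφ.integrable_mul hψ h 0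
  have i3 : Integrable fun x => φ (x - h) * ψ x := by
    simpa [sub_eq_add_neg] using hφ.integrable_mul hψ (-h) 0
  have i4 : Integrable fun x => φ x * ψ (x + h) := by simpa using hφ.integrable_mul hψ 0 h
  have i5 := hφ.integrable_mul hψ h h
  have e4 : ∫ x, φ x * ψ (x + h) = ∫ x, φ (x - h) * ψ x := by
    simpa using integral_add_right_eq_self (fun x => φ (x - h) * ψ x) h
  have e5 : ∫ x, φ (x + h) * ψ (x + h) = ∫ x, φ x * ψ x :=
    integral_add_right_eq_self (fun x => φ x * ψ x) h
  have l : ∫ x, (2 * φ x - φ (x + h) - φ (x - h)) * ψ x =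
      2 * (∫ x, φ x * ψ x) - (∫ x, φ (x + h) * ψ x) - ∫ x, φ (x - h) * ψ x := by
    rw [← integral_const_mul, ← integral_sub (i1.const_mul 2) i2,
      ← integral_sub (f := fun x => 2 * (φ x * ψ x) - φ (x + h) * ψ x)
        ((i1.const_mul 2).sub i2) i3]
    congr 1; ext x; ring
  have r : ∫ x, (φ (x + h) - φ x) * (ψ (x + h) - ψ x) =
      (∫ x, φ (x + h) * ψ (x + h)) + (∫ x, φ x * ψ x) - (∫ x, φ (x + h) * ψ x)
        - ∫ x, φ x * ψ (x + h) := by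
    rw [← integral_add i5 i1,
      ← integral_sub (f := fun x => φ (x + h) * ψ (x + h) + φ x * ψ x) (i5.add i1) i2,
      ← integral_sub (f := fun x => φ (x + h) * ψ (x + h) + φ x * ψ x - φ (x + h) * ψ x)
        ((i5.add i1).sub i2) i4]
    congr 1; ext x; ring
  rw [l, r, e4, e5]; ring

theorem IsTest.integrable_prod (hα0 : 0 < α) (hα2 : α < 2) (hφ : IsTest φ) (hψ : IsTest ψ) :
    Integrable (fun p : ℝ × ℝ =>
      (2 * φ p.1 - φ (p.1 + p.2) - φ (p.1 - p.2)) * (1 / |p.2| ^ (1 + α)) * ψ p.1)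
      (volume.prod volume) := by
  obtain ⟨C, hC⟩ := hφ.exists_secondDiff_bound
  have hc := hφ.continuous
  have hc' := hψ.continuous
  refine (hψ.integrable.norm.mul_prod ((integrable_min_mul_kernel hα0 hα2).const_mul C)).mono'
    ((by fun_prop : Measurable _).aestronglyMeasurable) (ae_of_all _ fun p => ?_)
  rw [norm_mul, norm_mul, Real.norm_of_nonneg (kernel_nonneg α p.2), ← mul_assoc C, mul_comm]
  exact mul_le_mul_of_nonneg_left
    (mul_le_mul_of_nonneg_right (hC p.1 p.2) (kernel_nonneg α p.2)) (abs_nonneg (ψ p.1))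

theorem IsTest.integrable_kernel_mul_integral (hα0 : 0 < α) (hα2 : α < 2) (hφ : IsTest φ)
    (hψ : IsTest ψ) :
    Integrable fun h =>
      1 / |h| ^ (1 + α) * ∫ x, (φ (x + h) - φ x) * (ψ (x + h) - ψ x) := by
  refine (hφ.integrable_prod hα0 hα2 hψ).integral_prod_right.congr (ae_of_all _ fun h => ?_)
  simp only
  rw [← hφ.integral_secondDiff_mul hψ, ← integral_const_mul]
  congr 1; ext x; ring

/-- The quadratic form as a double integral of increments, with the step `h` as outer variable. -/
theorem IsTest.integral_fracLap_mul (hα0 : 0 < α) (hα2 : α < 2) (hφ : IsTest φ)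
    (hψ : IsTest ψ) :
    ∫ x in D, fracLap α φ x * ψ x =
      c α / 2 * ∫ h, 1 / |h| ^ (1 + α) * ∫ x, (φ (x + h) - φ x) * (ψ (x + h) - ψ x) := by
  rw [hψ.integral_D]
  simp_rw [hφ.fracLap_eq hα0 hα2, mul_assoc]
  rw [integral_const_mul]
  congr 1
  simp_rw [← integral_mul_const]
  rw [integral_integral_swap (hφ.integrable_prod hα0 hα2 hψ)]
  congr 1; ext h
  rw [← hφ.integral_secondDiff_mul hψ, ← integral_const_mul]
  congr 1; ext x; ring

theorem c_nonneg (hα0 : 0 < α) : 0 ≤ c α := by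
  have := Real.Gamma_pos_of_pos (show 0 < (1 + α) / 2 by linarith)
  unfold c; positivity

theorem IsTest.fracLap_add (hα0 : 0 < α) (hα2 : α < 2) (hφ : IsTest φ) (hψ : IsTest ψ) :
    fracLap α (φ + ψ) = fracLap α φ + fracLap α ψ := by
  ext x
  rw [Pi.add_apply, (hφ.add hψ).fracLap_eq hα0 hα2, hφ.fracLap_eq hα0 hα2,
    hψ.fracLap_eq hα0 hα2, ← mul_add, ← integral_add
      (hφ.integrable_secondDiff_mul_kernel hα0 hα2 x)
      (hψ.integrable_secondDiff_mul_kernel hα0 hα2 x)]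
  congr 2; ext h; simp only [Pi.add_apply]; ring

theorem IsTest.fracLap_smul (hα0 : 0 < α) (hα2 : α < 2) (r : ℝ) (hφ : IsTest φ) :
    fracLap α (r • φ) = r • fracLap α φ := by
  ext x
  rw [Pi.smul_apply, (hφ.smul r).fracLap_eq hα0 hα2, hφ.fracLap_eq hα0 hα2, smul_eq_mul,
    mul_left_comm, ← integral_const_mul r]
  congr 2; ext h; simp only [Pi.smul_apply, smul_eq_mul]; ring

theorem IsTest.memLp (hφ : IsTest φ) : MemLp φ 2 (volume.restrict D) := by
  obtain ⟨B, hB⟩ := hφ.exists_bound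
  exact MemLp.of_bound hφ.continuous.aestronglyMeasurable B (ae_of_all _ hB)

theorem IsTest.memLp_fracLap (hα0 : 0 < α) (hα2 : α < 2) (hφ : IsTest φ) :
    MemLp (fracLap α φ) 2 (volume.restrict D) := by
  obtain ⟨C, hC⟩ := hφ.exists_secondDiff_bound
  have hc := hφ.continuous
  have hm : StronglyMeasurable (fracLap α φ) := by
    have : fracLap α φ = fun x => c α / 2 *
        ∫ h, (2 * φ x - φ (x + h) - φ (x - h)) * (1 / |h| ^ (1 + α)) :=
      funext (hφ.fracLap_eq hα0 hα2)
    rw [this]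
    refine StronglyMeasurable.const_mul (StronglyMeasurable.integral_prod_right
      (f := fun x h => (2 * φ x - φ (x + h) - φ (x - h)) * (1 / |h| ^ (1 + α))) ?_) _
    exact (by unfold Function.uncurry; fun_prop : Measurable _).stronglyMeasurable
  refine MemLp.of_bound hm.aestronglyMeasurable
    (c α / 2 * ∫ h : ℝ, C * (min 1 (h ^ 2) * (1 / |h| ^ (1 + α)))) (ae_of_all _ fun x => ?_)
  rw [hφ.fracLap_eq hα0 hα2, norm_mul, Real.norm_of_nonneg (by linarith [c_nonneg hα0])]
  refine mul_le_mul_of_nonneg_left ?_ (by linarith [c_nonneg hα0])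
  refine norm_integral_le_of_norm_le ((integrable_min_mul_kernel hα0 hα2).const_mul C)
    (ae_of_all _ fun h => ?_)
  rw [norm_mul, Real.norm_of_nonneg (kernel_nonneg α h), ← mul_assoc]
  exact mul_le_mul_of_nonneg_right (hC x h) (kernel_nonneg α h)

/-- The space `C_c^∞(D)`. -/
def Test : Submodule ℝ (ℝ → ℝ) where
  carrier := {φ | IsTest φ}
  add_mem' := IsTest.add
  zero_mem' := IsTest.zero
  smul_mem' r _ := IsTest.smul r

/-- The inclusion of `C_c^∞(D)` in `L²(D)`. -/
noncomputable def toL2 : Test →ₗ[ℝ] L2D where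
  toFun φ := (IsTest.memLp φ.2).toLp φ
  map_add' φ ψ := MemLp.toLp_add (IsTest.memLp φ.2) (IsTest.memLp ψ.2)
  map_smul' r φ := MemLp.toLp_const_smul r (IsTest.memLp φ.2)

/-- The operator `φ ↦ (A φ)|_D` from `C_c^∞(D)` to `L²(D)`. -/
noncomputable def lapL2 (hα0 : 0 < α) (hα2 : α < 2) : Test →ₗ[ℝ] L2D where
  toFun φ := (IsTest.memLp_fracLap hα0 hα2 φ.2).toLp (fracLap α φ)
  map_add' φ ψ := by
    rw [← MemLp.toLp_add]
    exact MemLp.toLp_congr _ _ (ae_of_all _ (congrFun (IsTest.fracLap_add hα0 hα2 φ.2 ψ.2)))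
  map_smul' r φ := by
    rw [RingHom.id_apply, ← MemLp.toLp_const_smul]
    exact MemLp.toLp_congr _ _ (ae_of_all _ (congrFun (IsTest.fracLap_smul hα0 hα2 r φ.2)))

theorem coeFn_toL2 (φ : Test) : toL2 φ =ᵐ[volume.restrict D] φ :=
  MemLp.coeFn_toLp (IsTest.memLp φ.2)

theorem coeFn_lapL2 (hα0 : 0 < α) (hα2 : α < 2) (φ : Test) :
    lapL2 hα0 hα2 φ =ᵐ[volume.restrict D] fracLap α φ :=
  MemLp.coeFn_toLp (IsTest.memLp_fracLap hα0 hα2 φ.2)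

theorem inner_toL2 (f : L2D) (φ : Test) :
    inner ℝ f (toL2 φ) = ∫ x in D, f x * (φ : ℝ → ℝ) x := by
  rw [L2.inner_def]
  refine integral_congr_ae ?_
  filter_upwards [coeFn_toL2 φ] with x hx
  rw [hx, real_inner_eq_re_inner, RCLike.inner_apply, mul_comm]; simp

theorem inner_lapL2_right (hα0 : 0 < α) (hα2 : α < 2) (f : L2D) (φ : Test) :
    inner ℝ f (lapL2 hα0 hα2 φ) = ∫ x in D, f x * fracLap α φ x := by
  rw [L2.inner_def]
  refine integral_congr_ae ?_
  filter_upwards [coeFn_lapL2 hα0 hα2 φ] with x hx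
  rw [hx, real_inner_eq_re_inner, RCLike.inner_apply, mul_comm]; simp

theorem inner_lapL2_toL2 (hα0 : 0 < α) (hα2 : α < 2) (φ ψ : Test) :
    inner ℝ (lapL2 hα0 hα2 φ) (toL2 ψ) = c α / 2 * ∫ h, 1 / |h| ^ (1 + α) *
      ∫ x, ((φ : ℝ → ℝ) (x + h) - (φ : ℝ → ℝ) x) * ((ψ : ℝ → ℝ) (x + h) - (ψ : ℝ → ℝ) x) := by
  rw [inner_toL2, ← IsTest.integral_fracLap_mul hα0 hα2 φ.2 ψ.2]
  refine integral_congr_ae ?_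
  filter_upwards [coeFn_lapL2 hα0 hα2 φ] with x hx
  rw [hx]

end form

/-! ### Friedrichs extensions -/

section Friedrichs

variable {X H : Type*} [AddCommGroup X] [Module ℝ X] [NormedAddCommGroup H]
  [InnerProductSpace ℝ H] {T A : X →ₗ[ℝ] H}

/-- The quadratic form of the operator `T φ ↦ A φ`, where `T : X → H` plays the role of the
inclusion of a space of test vectors. -/
noncomputable def form (T A : X →ₗ[ℝ] H) : LinearMap.BilinForm ℝ X := (innerₗ H).compl₁₂ A T

@[simp] theorem form_apply (φ ψ : X) : form T A φ ψ = inner ℝ (A φ) (T ψ) := rfl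

/-- The sequence `φ` converges to `f` in `H` and is Cauchy for the quadratic form, so that it
witnesses that `f` is in the form domain. -/
def FormApprox (T A : X →ₗ[ℝ] H) (f : H) (φ : ℕ → X) : Prop :=
  Tendsto (fun k => T (φ k)) atTop (𝓝 f) ∧
    ∀ δ : ℝ, 0 < δ → ∃ K : ℕ, ∀ j ≥ K, ∀ k ≥ K, form T A (φ j - φ k) (φ j - φ k) < δ

theorem form_add_le (hpos : ∀ φ, 0 ≤ form T A φ φ) (φ ψ : X) :
    form T A (φ + ψ) (φ + ψ) ≤ 2 * form T A φ φ + 2 * form T A ψ ψ := by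
  have := hpos (φ - ψ)
  simp only [map_add, map_sub, LinearMap.add_apply, LinearMap.sub_apply] at *
  linarith

/-- The graph of the Friedrichs extension of a nonnegative operator `T φ ↦ A φ`: the graph of the
adjoint, restricted to the form domain. -/
def friedrichs (T A : X →ₗ[ℝ] H) (hpos : ∀ φ, 0 ≤ form T A φ φ) : Submodule ℝ (H × H) where
  carrier := {p | (∃ φ, FormApprox T A p.1 φ) ∧ ∀ ψ, inner ℝ p.1 (A ψ) = inner ℝ p.2 (T ψ)}
  add_mem' := by
    rintro ⟨f, g⟩ ⟨f', g'⟩ ⟨⟨φ, h1, h2⟩, h3⟩ ⟨⟨φ', h1', h2'⟩, h3'⟩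
    refine ⟨⟨fun k => φ k + φ' k, ?_, fun δ hδ => ?_⟩, fun ψ => ?_⟩
    · simpa only [map_add, Prod.fst_add] using h1.add h1'
    · obtain ⟨K, hK⟩ := h2 (δ / 4) (by linarith)
      obtain ⟨K', hK'⟩ := h2' (δ / 4) (by linarith)
      refine ⟨max K K', fun j hj k hk => ?_⟩
      have a := hK j (le_trans (le_max_left _ _) hj) k (le_trans (le_max_left _ _) hk)
      have b := hK' j (le_trans (le_max_right _ _) hj) k (le_trans (le_max_right _ _) hk)
      have := form_add_le hpos (φ j - φ k) (φ' j - φ' k)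
      rw [add_sub_add_comm]
      linarith
    · simp only [Prod.mk_add_mk, inner_add_left] at *
      rw [h3, h3']
  zero_mem' := ⟨⟨0, by simp, fun δ hδ => ⟨0, fun j _ k _ => by simpa using hδ⟩⟩,
    fun ψ => by simp⟩
  smul_mem' := by
    rintro r ⟨f, g⟩ ⟨⟨φ, h1, h2⟩, h3⟩
    refine ⟨⟨fun k => r • φ k, ?_, fun δ hδ => ?_⟩, fun ψ => ?_⟩
    · simpa only [map_smul, Prod.smul_fst] using h1.const_smul r
    · have hr : 0 < r ^ 2 + 1 := by positivity
      obtain ⟨K, hK⟩ := h2 (δ / (r ^ 2 + 1)) (by positivity)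
      refine ⟨K, fun j hj k hk => ?_⟩
      have a := hK j hj k hk
      rw [lt_div_iff₀ hr] at a
      have := hpos (φ j - φ k)
      rw [← smul_sub, LinearMap.BilinForm.smul_left, LinearMap.BilinForm.smul_right]
      nlinarith
    · simp only [Prod.smul_mk, inner_smul_left] at *
      rw [h3]

theorem FormApprox.exists_bound (hpos : ∀ φ, 0 ≤ form T A φ φ) {f : H} {φ : ℕ → X}
    (h : FormApprox T A f φ) : ∃ C, 0 < C ∧ ∃ K, ∀ k ≥ K, form T A (φ k) (φ k) ≤ C := by
  obtain ⟨K, hK⟩ := h.2 1 one_pos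
  refine ⟨2 * form T A (φ K) (φ K) + 2, by linarith [hpos (φ K)], K, fun k hk => ?_⟩
  have a := hK k hk K le_rfl
  have b := form_add_le hpos (φ K) (φ k - φ K)
  rw [add_sub_cancel] at b
  linarith

/-- The form of two approximating sequences converges to the pairing with the Friedrichs extension.
By the Cauchy-Schwarz inequality for the form, the two indices may be sent to infinity one after
the other. -/
theorem tendsto_form (hsymm : (form T A).IsSymm) (hpos : ∀ φ, 0 ≤ form T A φ φ)
    {f g f' : H} {φ ψ : ℕ → X} (hφ : FormApprox T A f φ)
    (hadj : ∀ ψ, inner ℝ f (A ψ) = inner ℝ g (T ψ)) (hψ : FormApprox T A f' ψ) :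
    Tendsto (fun k => form T A (φ k) (ψ k)) atTop (𝓝 (inner ℝ g f')) := by
  obtain ⟨C, hC, K, hK⟩ := hψ.exists_bound hpos
  have hsq : Tendsto (fun k => (form T A (φ k) (ψ k) - inner ℝ g (T (ψ k))) ^ 2) atTop (𝓝 0) := by
    refine Metric.tendsto_atTop.2 fun δ hδ => ?_
    obtain ⟨K', hK'⟩ := hφ.2 (δ / 2 / C) (by positivity)
    refine ⟨max K K', fun k hk => ?_⟩
    have hkC := hK k (le_trans (le_max_left _ _) hk)
    have hk' := le_trans (le_max_right _ _) hk
    have hlim : Tendsto (fun j => (form T A (φ k) (ψ k) - form T A (φ j) (ψ k)) ^ 2) atTop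
        (𝓝 ((form T A (φ k) (ψ k) - inner ℝ g (T (ψ k))) ^ 2)) := by
      refine (tendsto_const_nhds.sub ?_).pow 2
      rw [← hadj]
      refine (hφ.1.inner tendsto_const_nhds).congr fun j => ?_
      have := hsymm.eq (φ j) (ψ k)
      simp only [form_apply] at this
      rw [form_apply, this, real_inner_comm]
    have hle : (form T A (φ k) (ψ k) - inner ℝ g (T (ψ k))) ^ 2 ≤ δ / 2 := by
      refine le_of_tendsto hlim ?_
      filter_upwards [eventually_ge_atTop K'] with j hj
      have cs := (form T A).apply_sq_le_of_symm hpos ⟨hsymm.eq⟩ (φ k - φ j) (ψ k)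
      rw [map_sub, LinearMap.sub_apply] at cs
      refine cs.trans ?_
      calc _ ≤ δ / 2 / C * C :=
            mul_le_mul (by simpa using (hK' k hk' j hj).le) hkC (hpos _) (by positivity)
        _ = δ / 2 := by field_simp
    rw [Real.dist_0_eq_abs, abs_of_nonneg (sq_nonneg _)]
    linarith
  have hz : Tendsto (fun k => form T A (φ k) (ψ k) - inner ℝ g (T (ψ k))) atTop (𝓝 0) := by
    rw [tendsto_zero_iff_abs_tendsto_zero]
    simpa [Function.comp_def, Real.sqrt_sq_eq_abs] using hsq.sqrt
  simpa using hz.add ((tendsto_const_nhds (x := g)).inner hψ.1)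

theorem inner_symm_of_mem_friedrichs (hsymm : (form T A).IsSymm)
    (hpos : ∀ φ, 0 ≤ form T A φ φ) {f g f' g' : H} (h : (f, g) ∈ friedrichs T A hpos)
    (h' : (f', g') ∈ friedrichs T A hpos) : inner ℝ g f' = inner ℝ g' f := by
  obtain ⟨⟨φ, hφ⟩, hf⟩ := h
  obtain ⟨⟨φ', hφ'⟩, hf'⟩ := h'
  refine tendsto_nhds_unique (tendsto_form hsymm hpos hφ hf hφ') ?_
  exact (tendsto_form hsymm hpos hφ' hf' hφ).congr fun k => hsymm.eq _ _

/-- A lower bound for the quadratic form by a functional that is continuous on `H` extends from test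
vectors to the domain of the Friedrichs extension. -/
theorem le_inner_of_mem_friedrichs (hsymm : (form T A).IsSymm)
    (hpos : ∀ φ, 0 ≤ form T A φ φ) {q : H → ℝ} (hq : Continuous q)
    (hle : ∀ φ, q (T φ) ≤ form T A φ φ) {f g : H} (h : (f, g) ∈ friedrichs T A hpos) :
    q f ≤ inner ℝ g f := by
  obtain ⟨⟨φ, hφ⟩, hf⟩ := h
  exact le_of_tendsto_of_tendsto' ((hq.tendsto f).comp hφ.1) (tendsto_form hsymm hpos hφ hf hφ)
    fun k => hle (φ k)

/-- On the span of eigenvectors with eigenvalues at most `t` the quadratic form is at most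
`t ‖f‖²`. -/
theorem inner_sum_eigenvectors_le (hsymm : (form T A).IsSymm)
    (hpos : ∀ φ, 0 ≤ form T A φ φ) {ι : Type*} [Fintype ι] {φ : ι → H} {μ : ι → ℝ} {t : ℝ}
    (h : ∀ i, (φ i, μ i • φ i) ∈ friedrichs T A hpos) (hμ : ∀ i, μ i ≤ t) (a : ι → ℝ) :
    inner ℝ (∑ i, a i • μ i • φ i) (∑ i, a i • φ i) ≤ t * ‖∑ i, a i • φ i‖ ^ 2 := by
  -- eigenvectors for different eigenvalues are orthogonal, so that the difference of the two sides
  -- is the square of the norm of `∑ i, a i • √(t - μ i) • φ i`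
  have horth : ∀ i j, μ i = μ j ∨ inner ℝ (φ i) (φ j) = 0 := fun i j => by
    have := inner_symm_of_mem_friedrichs hsymm hpos (h i) (h j)
    rw [inner_smul_left, inner_smul_left, real_inner_comm (φ i) (φ j)] at this
    simpa using this
  have key : t * ‖∑ i, a i • φ i‖ ^ 2 - inner ℝ (∑ i, a i • μ i • φ i) (∑ i, a i • φ i) =
      ‖∑ i, a i • √(t - μ i) • φ i‖ ^ 2 := by
    rw [← real_inner_self_eq_norm_sq, ← real_inner_self_eq_norm_sq]
    simp only [sum_inner, inner_sum, inner_smul_left, inner_smul_right, Finset.mul_sum,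
      ← Finset.sum_sub_distrib]
    refine Finset.sum_congr rfl fun i _ => Finset.sum_congr rfl fun j _ => ?_
    rcases horth i j with hij | hij
    · have := Real.mul_self_sqrt (sub_nonneg.2 (hμ i))
      simp only [conj_trivial]
      rw [← hij, real_inner_comm (φ i) (φ j)]
      linear_combination (-a i * a j * inner ℝ (φ i) (φ j)) * this
    · rw [real_inner_comm] at hij
      simp [hij]
  linarith [sq_nonneg ‖∑ i, a i • √(t - μ i) • φ i‖]

end Friedrichs

section

variable {α : ℝ}

theorem form_lapL2_isSymm (hα0 : 0 < α) (hα2 : α < 2) : (form toL2 (lapL2 hα0 hα2)).IsSymm :=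
  ⟨fun φ ψ => by
    simp only [form_apply, inner_lapL2_toL2, mul_comm]⟩

theorem form_lapL2_nonneg (hα0 : 0 < α) (hα2 : α < 2) (φ : Test) :
    0 ≤ form toL2 (lapL2 hα0 hα2) φ φ := by
  rw [form_apply, inner_lapL2_toL2]
  exact mul_nonneg (by linarith [c_nonneg hα0]) (integral_nonneg fun h =>
    mul_nonneg (kernel_nonneg α h) (integral_nonneg fun x => mul_self_nonneg _))

theorem IsAD.mem_friedrichs (hα0 : 0 < α) (hα2 : α < 2) {f g : L2D} (h : IsAD α f g) :
    (f, g) ∈ friedrichs toL2 (lapL2 hα0 hα2) (form_lapL2_nonneg hα0 hα2) := by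
  obtain ⟨⟨φ, hφ, hlim, hcauchy⟩, hadj⟩ := h
  let Φ : ℕ → Test := fun k => ⟨φ k, hφ k⟩
  refine ⟨⟨Φ, ?_, fun δ hδ => ?_⟩, fun ψ => ?_⟩
  · rw [Lp.tendsto_Lp_iff_tendsto_eLpNorm']
    refine hlim.congr fun k => eLpNorm_congr_ae ?_
    filter_upwards [coeFn_toL2 (Φ k)] with x hx
    rw [Pi.sub_apply, hx]
  · obtain ⟨K, hK⟩ := hcauchy δ hδ
    refine ⟨K, fun j hj k hk => ?_⟩
    convert hK j hj k hk using 1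
    rw [form_apply, inner_toL2]
    refine integral_congr_ae ?_
    filter_upwards [coeFn_lapL2 hα0 hα2 (Φ j - Φ k)] with x hx
    rw [hx]; rfl
  · rw [inner_lapL2_right, inner_toL2]
    exact hadj ψ ψ.2

end

/-! ### Discretization of the kernel -/

section

variable {α ε : ℝ} {φ : ℝ → ℝ}

/-- The index of the cell `[-1 + ε m, -1 + ε (m + 1))` that contains `x`. -/
noncomputable def cell (ε x : ℝ) : ℤ := ⌊(x + 1) / ε⌋

/-- The kernel `|m|^{-1-α}` on the integers, with the distance `|m|` increased to `|m| + 1`. -/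
noncomputable def weight (α : ℝ) (m : ℤ) : ℝ := 1 / (|(m : ℝ)| + 1) ^ (1 + α)

theorem weight_nonneg (α : ℝ) (m : ℤ) : 0 ≤ weight α m := by unfold weight; positivity

theorem weight_neg (α : ℝ) (m : ℤ) : weight α (-m) = weight α m := by simp [weight]

theorem weight_le_one (hα0 : 0 < α) (m : ℤ) : weight α m ≤ 1 := by
  unfold weight
  exact div_le_one_of_le₀ (Real.one_le_rpow (by linarith [abs_nonneg (m : ℝ)]) (by linarith))
    (by positivity)

theorem measurable_cell (ε : ℝ) : Measurable (cell ε) := by unfold cell; fun_prop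

theorem measurable_weight_cell (α ε : ℝ) :
    Measurable fun p : ℝ × ℝ => weight α (cell ε p.1 - cell ε p.2) :=
  (measurable_of_countable (weight α)).comp
    (((measurable_cell ε).comp measurable_fst).sub ((measurable_cell ε).comp measurable_snd))

theorem cell_preimage_singleton (hε : 0 < ε) (m : ℤ) :
    cell ε ⁻¹' {m} = Ico (-1 + ε * m) (-1 + ε * (m + 1)) := by
  ext x
  rw [mem_preimage, mem_singleton_iff, cell, Int.floor_eq_iff, le_div_iff₀ hε, div_lt_iff₀ hε,
    mem_Ico]
  constructor <;> rintro ⟨h1, h2⟩ <;> constructor <;> linarith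

theorem map_cell_volume (hε : 0 < ε) :
    volume.map (cell ε) = ENNReal.ofReal ε • Measure.count := by
  refine Measure.ext_iff_singleton.2 fun m => ?_
  rw [Measure.map_apply (measurable_cell ε) (measurableSet_singleton m),
    cell_preimage_singleton hε, Real.volume_Ico]
  simp only [Measure.smul_apply, Measure.count_singleton, smul_eq_mul, mul_one]
  congr 1; ring

theorem integrable_comp_cell (hε : 0 < ε) {g : ℤ → ℝ} (hg : Summable g) :
    Integrable fun y => g (cell ε y) := by
  refine Integrable.comp_measurable (f := cell ε) (g := g) ?_ (measurable_cell ε)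
  rw [map_cell_volume hε]
  exact (integrable_count_iff.2 hg.norm).smul_measure ENNReal.ofReal_ne_top

theorem integral_comp_cell (hε : 0 < ε) {g : ℤ → ℝ} {s : ℝ} (hg : HasSum g s) :
    ∫ y, g (cell ε y) = ε * s := by
  have hi : Integrable g Measure.count := integrable_count_iff.2 hg.summable.norm
  rw [← integral_map (f := g) (measurable_cell ε).aemeasurable
    (measurable_of_countable g).aestronglyMeasurable, map_cell_volume hε, integral_smul_measure,
    integral_countable hi, ENNReal.toReal_ofReal hε.le, smul_eq_mul, ← hg.tsum_eq]
  simp [Measure.real]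

theorem hasSum_one_div_nat_add_one_rpow (hα0 : 0 < α) :
    HasSum (fun n : ℕ => 1 / ((n : ℝ) + 1) ^ (1 + α)) (zetaOnePlus α) := by
  have hs : Summable (fun n : ℕ => 1 / ((n : ℝ) + 1) ^ (1 + α)) := by
    refine ((Real.summable_one_div_nat_add_rpow 1 (1 + α)).2 (by linarith)).congr fun n => ?_
    rw [abs_of_pos (by positivity)]
  convert hs.hasSum using 1
  rw [zetaOnePlus, zeta_eq_tsum_one_div_nat_add_one_cpow (by simpa using hα0),
    ← Complex.ofReal_re (∑' n : ℕ, 1 / ((n : ℝ) + 1) ^ (1 + α)), Complex.ofReal_tsum]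
  congr 2; ext n
  rw [Complex.ofReal_div, Complex.ofReal_cpow (by positivity)]
  push_cast; rfl

theorem hasSum_weight (hα0 : 0 < α) : HasSum (weight α) (2 * zetaOnePlus α - 1) := by
  have h := hasSum_one_div_nat_add_one_rpow hα0
  have := HasSum.of_nat_of_neg (f := weight α) (g := zetaOnePlus α) (g' := zetaOnePlus α)
    (by simpa [weight] using h) (by simpa [weight] using h)
  have h0 : weight α 0 = 1 := by simp [weight]
  rwa [h0, ← two_mul] at this

theorem hasSum_weight_sub (hα0 : 0 < α) (m : ℤ) :
    HasSum (fun k => weight α (m - k)) (2 * zetaOnePlus α - 1) :=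
  ((Equiv.subLeft m).hasSum_iff (f := weight α)).2 (hasSum_weight hα0)

/-- Points of the cells `p` and `q` are at a distance of at most `ε (|p - q| + 1)`. -/
theorem weight_cell_le (hα0 : 0 < α) (hε : 0 < ε) {x y : ℝ} (hxy : x ≠ y) :
    weight α (cell ε x - cell ε y) / ε ^ (1 + α) ≤ 1 / |y - x| ^ (1 + α) := by
  rw [weight, div_div, ← Real.mul_rpow (by positivity) hε.le]
  refine one_div_le_one_div_of_le
    (Real.rpow_pos_of_pos (abs_pos.2 (sub_ne_zero.2 hxy.symm)) _)
    (Real.rpow_le_rpow (abs_nonneg _) ?_ (by linarith))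
  have hx1 := Int.floor_le ((x + 1) / ε)
  have hx2 := Int.lt_floor_add_one ((x + 1) / ε)
  have hy1 := Int.floor_le ((y + 1) / ε)
  have hy2 := Int.lt_floor_add_one ((y + 1) / ε)
  rw [← div_le_iff₀ hε, ← abs_of_pos hε, ← abs_div, abs_of_pos hε,
    show (y - x) / ε = (y + 1) / ε - (x + 1) / ε by ring]
  push_cast
  have h1 := le_abs_self ((cell ε x : ℝ) - cell ε y)
  have h2 := neg_abs_le ((cell ε x : ℝ) - cell ε y)
  unfold cell at *
  rw [abs_le]
  constructor <;> linarith

theorem IsTest.integrable_sq_mul_weight (hα0 : 0 < α) (hε : 0 < ε) (hφ : IsTest φ) :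
    Integrable (fun p : ℝ × ℝ => φ p.1 ^ 2 * weight α (cell ε p.1 - cell ε p.2))
      (volume.prod volume) := by
  have hc := hφ.continuous
  have hm := measurable_weight_cell α ε
  have hI : ∀ m, Integrable fun y => weight α (m - cell ε y) := fun m =>
    integrable_comp_cell hε (hasSum_weight_sub hα0 m).summable
  refine (integrable_prod_iff (by fun_prop : Measurable _).aestronglyMeasurable).2
    ⟨ae_of_all _ fun x => (hI (cell ε x)).const_mul (φ x ^ 2), ?_⟩
  have h2 : Integrable fun x => φ x ^ 2 := by simpa [sq] using hφ.integrable_mul hφ 0 0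
  refine (h2.mul_const (ε * (2 * zetaOnePlus α - 1))).congr (ae_of_all _ fun x => ?_)
  simp only [norm_mul, norm_pow, sq_abs, Real.norm_eq_abs, abs_of_nonneg (weight_nonneg α _)]
  rw [integral_const_mul, integral_comp_cell hε (hasSum_weight_sub hα0 _)]

theorem IsTest.integral_sq_mul_weight (hα0 : 0 < α) (hε : 0 < ε) (hφ : IsTest φ) :
    ∫ p : ℝ × ℝ, φ p.1 ^ 2 * weight α (cell ε p.1 - cell ε p.2) ∂(volume.prod volume) =
      ε * (2 * zetaOnePlus α - 1) * ∫ x, φ x ^ 2 := by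
  rw [integral_prod _ (hφ.integrable_sq_mul_weight hα0 hε), ← integral_const_mul]
  congr 1; ext x
  simp only
  rw [integral_const_mul, integral_comp_cell hε (hasSum_weight_sub hα0 _)]
  ring

theorem IsTest.integrable_mul_mul_weight (hα0 : 0 < α) (hφ : IsTest φ) :
    Integrable (fun p : ℝ × ℝ => φ p.1 * φ p.2 * weight α (cell ε p.1 - cell ε p.2))
      (volume.prod volume) :=
  (hφ.integrable.mul_prod hφ.integrable).mul_bdd
    (measurable_weight_cell α ε).aestronglyMeasurable (c := 1)
    (ae_of_all _ fun p => by
      rw [Real.norm_of_nonneg (weight_nonneg α _)]; exact weight_le_one hα0 _)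

theorem cell_mem_of_mem_D {N : ℕ} (hN : 0 < N) {x : ℝ} (hx : x ∈ D) :
    ∃ p : Fin N, cell (2 / N) x = p := by
  have hN' : (0 : ℝ) < N := by exact_mod_cast hN
  obtain ⟨h1, h2⟩ := hx
  have h0 : 0 ≤ cell (2 / N) x :=
    Int.floor_nonneg.2 (div_nonneg (by linarith) (by positivity))
  have hlt : cell (2 / N) x < N := by
    refine Int.floor_lt.2 ?_
    rw [div_lt_iff₀ (by positivity)]
    push_cast
    rw [mul_div_cancel₀ _ hN'.ne']
    linarith
  obtain ⟨k, hk⟩ := Int.eq_ofNat_of_zero_le h0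
  exact ⟨⟨k, by omega⟩, by simpa using hk⟩

theorem IsTest.sum_indicator_cell {N : ℕ} (hN : 0 < N) (hφ : IsTest φ) (x : ℝ) :
    ∑ p : Fin N, (cell (2 / N) ⁻¹' {(p : ℤ)}).indicator φ x = φ x := by
  by_cases hx : x ∈ D
  · obtain ⟨p, hp⟩ := cell_mem_of_mem_D hN hx
    rw [Finset.sum_eq_single p]
    · exact indicator_of_mem (by simpa using hp) φ
    · intro q _ hq
      refine indicator_of_notMem ?_ φ
      rw [mem_preimage, hp, mem_singleton_iff]
      exact fun h => hq (Fin.ext (by exact_mod_cast h.symm))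
    · simp
  · rw [hφ.eq_zero hx]
    exact Finset.sum_eq_zero fun p _ => by simp [indicator, hφ.eq_zero hx]

theorem IsTest.integral_mul_mul_weight {N : ℕ} (hN : 0 < N) (hφ : IsTest φ) :
    ∫ p : ℝ × ℝ, φ p.1 * φ p.2 * weight α (cell (2 / N) p.1 - cell (2 / N) p.2)
        ∂(volume.prod volume) =
      ∑ p : Fin N, ∑ q : Fin N, weight α ((p : ℤ) - (q : ℤ)) *
        ((∫ x in cell (2 / N) ⁻¹' {(p : ℤ)}, φ x) * ∫ x in cell (2 / N) ⁻¹' {(q : ℤ)}, φ x) := by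
  have hms : ∀ p : ℤ, MeasurableSet (cell (2 / N) ⁻¹' {p}) := fun p =>
    measurable_cell _ (measurableSet_singleton p)
  simp_rw [← integral_indicator (hms _), ← integral_prod_mul, ← integral_const_mul]
  have hint : ∀ p q : ℤ, Integrable (fun z : ℝ × ℝ => weight α (p - q) *
      ((cell (2 / N) ⁻¹' {p}).indicator φ z.1 * (cell (2 / N) ⁻¹' {q}).indicator φ z.2))
      (volume.prod volume) := fun p q =>
    ((hφ.integrable.indicator (hms p)).mul_prod (hφ.integrable.indicator (hms q))).const_mul _
  simp_rw [← integral_finsetSum _ fun q _ => hint _ _]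
  rw [← integral_finsetSum _ fun p _ => integrable_finsetSum _ fun q _ => hint _ _]
  congr 1; ext z
  have hpt : ∀ p q : ℤ, weight α (p - q) *
      ((cell (2 / N) ⁻¹' {p}).indicator φ z.1 * (cell (2 / N) ⁻¹' {q}).indicator φ z.2) =
      weight α (cell (2 / N) z.1 - cell (2 / N) z.2) *
      ((cell (2 / N) ⁻¹' {p}).indicator φ z.1 * (cell (2 / N) ⁻¹' {q}).indicator φ z.2) := by
    intro p q
    by_cases h1 : cell (2 / N) z.1 = p
    · by_cases h2 : cell (2 / N) z.2 = q
      · rw [h1, h2]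
      · simp [indicator, h2]
    · simp [indicator, h1]
  simp_rw [hpt, ← Finset.mul_sum, ← Finset.sum_mul, hφ.sum_indicator_cell hN]
  ring

/-- The double integral of squared increments against the discretized kernel. -/
theorem IsTest.integral_increment_sq_mul_weight (hα0 : 0 < α) {N : ℕ} (hN : 0 < N)
    (hφ : IsTest φ) :
    Integrable (fun p : ℝ × ℝ => (φ p.2 - φ p.1) ^ 2 *
        weight α (cell (2 / N) p.1 - cell (2 / N) p.2)) (volume.prod volume) ∧
    ∫ p : ℝ × ℝ, (φ p.2 - φ p.1) ^ 2 * weight α (cell (2 / N) p.1 - cell (2 / N) p.2)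
        ∂(volume.prod volume) =
      2 * (2 / N * (2 * zetaOnePlus α - 1) * ∫ x, φ x ^ 2) -
        2 * ∑ p : Fin N, ∑ q : Fin N, weight α ((p : ℤ) - (q : ℤ)) *
        ((∫ x in cell (2 / N) ⁻¹' {(p : ℤ)}, φ x) * ∫ x in cell (2 / N) ⁻¹' {(q : ℤ)}, φ x) := by
  have hε : (0 : ℝ) < 2 / N := by positivity
  set f : ℝ × ℝ → ℝ := fun p => φ p.1 ^ 2 * weight α (cell (2 / N) p.1 - cell (2 / N) p.2)
  have i1 : Integrable f (volume.prod volume) := hφ.integrable_sq_mul_weight hα0 hε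
  have i2 : Integrable (fun p => f p.swap) (volume.prod volume) := i1.swap
  have i3 := hφ.integrable_mul_mul_weight (ε := 2 / N) hα0
  have e : (fun p : ℝ × ℝ => (φ p.2 - φ p.1) ^ 2 *
      weight α (cell (2 / N) p.1 - cell (2 / N) p.2)) = fun p => (f p + f p.swap) -
        2 * (φ p.1 * φ p.2 * weight α (cell (2 / N) p.1 - cell (2 / N) p.2)) := by
    ext p
    simp only [f, Prod.fst_swap, Prod.snd_swap]
    rw [← weight_neg α (cell (2 / N) p.2 - cell (2 / N) p.1), neg_sub]
    ring
  rw [e]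
  refine ⟨(i1.add i2).sub (i3.const_mul 2), ?_⟩
  rw [integral_sub (f := fun p => f p + f p.swap) (i1.add i2) (i3.const_mul 2),
    integral_add i1 i2, integral_prod_swap, integral_const_mul,
    hφ.integral_sq_mul_weight hα0 hε, hφ.integral_mul_mul_weight hN]
  ring

/-- Passing to the discretized kernel decreases the quadratic form. -/
theorem IsTest.integral_increment_sq_mul_weight_le (hα0 : 0 < α) (hα2 : α < 2) {N : ℕ}
    (hN : 0 < N) (hφ : IsTest φ) :
    (∫ p : ℝ × ℝ, (φ p.2 - φ p.1) ^ 2 * weight α (cell (2 / N) p.1 - cell (2 / N) p.2)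
        ∂(volume.prod volume)) / (2 / (N : ℝ)) ^ (1 + α) ≤
      ∫ h, 1 / |h| ^ (1 + α) * ∫ x, (φ (x + h) - φ x) * (φ (x + h) - φ x) := by
  have hε : (0 : ℝ) < 2 / N := by positivity
  set F : ℝ × ℝ → ℝ := fun p => (φ p.2 - φ p.1) ^ 2 *
    weight α (cell (2 / N) p.1 - cell (2 / N) p.2)
  have hF : Integrable F (volume.prod volume) :=
    (hφ.integral_increment_sq_mul_weight hα0 hN).1
  have hmp := measurePreserving_prod_add (volume : Measure ℝ) (volume : Measure ℝ)
  have hF' : Integrable (fun z : ℝ × ℝ => F (z.1, z.1 + z.2)) (volume.prod volume) :=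
    hmp.integrable_comp_of_integrable hF
  have e : ∫ p, F p ∂(volume.prod volume) = ∫ h, ∫ x, F (x, x + h) := by
    rw [← hmp.integral_comp (MeasurableEquiv.shearAddRight ℝ).measurableEmbedding]
    exact integral_prod_symm _ hF'
  rw [e, ← integral_div]
  have hae : ∀ᵐ h : ℝ, h ≠ 0 := by simp [ae_iff]
  refine integral_mono_ae (hF'.integral_prod_right.div_const _)
    (hφ.integrable_kernel_mul_integral hα0 hα2 hφ) ?_
  filter_upwards [hF'.prod_left_ae, hae] with h hh h0
  rw [← integral_div, ← integral_const_mul]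
  have i4 := hφ.integrable_mul hφ 0 h
  have i5 := hφ.integrable_mul hφ h h
  have i0 := hφ.integrable_mul hφ 0 0
  have hsq : Integrable fun x => (φ (x + h) - φ x) * (φ (x + h) - φ x) := by
    refine ((i5.add i0).sub (i4.const_mul 2)).congr (ae_of_all _ fun x => ?_)
    simp only [Pi.add_apply, Pi.sub_apply, add_zero]
    ring
  refine integral_mono (hh.div_const _) (hsq.const_mul _) fun x => ?_
  simp only [F]
  rw [mul_div_assoc, sq, mul_comm]
  refine mul_le_mul_of_nonneg_right ?_ (mul_self_nonneg _)
  have := weight_cell_le (ε := 2 / N) hα0 hε (x := x) (y := x + h) (by simpa using h0)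
  rwa [add_sub_cancel_left] at this

/-- The normalized indicators of the `N` cells, as elements of `L²(D)`. -/
noncomputable def cellVec (N : ℕ) (p : Fin N) : L2D :=
  indicatorConstLp 2 (measurable_cell (2 / N) (measurableSet_singleton (p : ℤ)))
    (measure_ne_top (volume.restrict D) _) ((√(2 / (N : ℝ)))⁻¹)

theorem orthonormal_cellVec {N : ℕ} (hN : 0 < N) : Orthonormal ℝ (cellVec N) := by
  have hN' : (0 : ℝ) < N := by exact_mod_cast hN
  have hε : (0 : ℝ) < 2 / N := by positivity
  rw [orthonormal_iff_ite]
  intro p q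
  rw [cellVec, cellVec, L2.inner_indicatorConstLp_indicatorConstLp]
  split_ifs with h
  · subst h
    have hsub : cell (2 / N) ⁻¹' {(p : ℤ)} ⊆ Ico (-1 : ℝ) 1 := by
      rw [cell_preimage_singleton hε]
      have hp : ((p : ℕ) : ℝ) + 1 ≤ N := by exact_mod_cast p.2
      have h2 : 2 / (N : ℝ) * (((p : ℕ) : ℝ) + 1) ≤ 2 / N * N :=
        mul_le_mul_of_nonneg_left hp hε.le
      rw [div_mul_cancel₀ _ hN'.ne'] at h2
      refine Ico_subset_Ico ?_ ?_
      · have : 0 ≤ 2 / (N : ℝ) * (((p : ℕ) : ℤ) : ℝ) := by positivity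
        linarith
      · push_cast; linarith
    rw [inter_self, restrict_Ioo_eq_restrict_Ico, measureReal_restrict_apply
      (measurable_cell _ (measurableSet_singleton _)), inter_eq_left.2 hsub,
      cell_preimage_singleton hε, Real.volume_real_Ico_of_le (by nlinarith)]
    have hs := Real.mul_self_sqrt hε.le
    simp only [smul_eq_mul, RCLike.inner_apply, conj_trivial]
    rw [← mul_inv, hs]
    field_simp
    ring
  · have : cell (2 / N) ⁻¹' {(p : ℤ)} ∩ cell (2 / N) ⁻¹' {(q : ℤ)} = ∅ := by
      ext x
      simp only [mem_inter_iff, mem_preimage, mem_singleton_iff, mem_empty_iff_false, iff_false]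
      rintro ⟨h1, h2⟩
      exact h (Fin.ext (by exact_mod_cast h1.symm.trans h2))
    simp [this]

theorem inner_cellVec_toL2 (N : ℕ) (p : Fin N) (φ : Test) :
    inner ℝ (cellVec N p) (toL2 φ) =
      (√(2 / (N : ℝ)))⁻¹ * ∫ x in cell (2 / N) ⁻¹' {(p : ℤ)}, (φ : ℝ → ℝ) x := by
  have hm : MeasurableSet (cell (2 / N) ⁻¹' {(p : ℤ)}) :=
    measurable_cell _ (measurableSet_singleton _)
  rw [cellVec, L2.inner_indicatorConstLp_eq_inner_setIntegral, RCLike.inner_apply, conj_trivial,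
    mul_comm]
  congr 1
  rw [← integral_indicator hm, ← integral_indicator hm]
  have e : ∫ x in D, (cell (2 / N) ⁻¹' {(p : ℤ)}).indicator (toL2 φ) x =
      ∫ x in D, (cell (2 / N) ⁻¹' {(p : ℤ)}).indicator (φ : ℝ → ℝ) x := by
    refine integral_congr_ae ?_
    filter_upwards [coeFn_toL2 φ] with x hx
    simp only [indicator, hx]
  rw [e]
  exact setIntegral_eq_integral_of_forall_compl_eq_zero fun x hx => by
    simp [indicator, IsTest.eq_zero φ.2 hx]

/-- The discretized quadratic form on `L²(D)`. -/
noncomputable def discreteForm (α : ℝ) (N : ℕ) (f : L2D) : ℝ :=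
  c α / (2 / (N : ℝ)) ^ α * ((2 * zetaOnePlus α - 1) * ‖f‖ ^ 2 -
    ∑ p : Fin N, ∑ q : Fin N, weight α ((p : ℤ) - (q : ℤ)) *
      (inner ℝ (cellVec N p) f * inner ℝ (cellVec N q) f))

theorem continuous_discreteForm (α : ℝ) (N : ℕ) : Continuous (discreteForm α N) := by
  unfold discreteForm; fun_prop

theorem discreteForm_toL2_le (hα0 : 0 < α) (hα2 : α < 2) {N : ℕ} (hN : 0 < N) (φ : Test) :
    discreteForm α N (toL2 φ) ≤ form toL2 (lapL2 hα0 hα2) φ φ := by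
  have hφ : IsTest (φ : ℝ → ℝ) := φ.2
  have hε : (0 : ℝ) < 2 / N := by positivity
  have hc := c_nonneg hα0
  rw [form_apply, inner_lapL2_toL2]
  refine le_trans (le_of_eq ?_) (mul_le_mul_of_nonneg_left
    (hφ.integral_increment_sq_mul_weight_le hα0 hα2 hN) (by linarith))
  rw [(hφ.integral_increment_sq_mul_weight hα0 hN).2, discreteForm]
  have hn : ‖toL2 φ‖ ^ 2 = ∫ x, (φ : ℝ → ℝ) x ^ 2 := by
    rw [← real_inner_self_eq_norm_sq, inner_toL2]
    have : ∫ x in D, toL2 φ x * (φ : ℝ → ℝ) x = ∫ x in D, (φ : ℝ → ℝ) x * (φ : ℝ → ℝ) x := by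
      refine integral_congr_ae ?_
      filter_upwards [coeFn_toL2 φ] with x hx
      rw [hx]
    rw [this, hφ.integral_D]
    simp only [sq]
  have hs := Real.mul_self_sqrt hε.le
  have hsi : (2 / (N : ℝ))⁻¹ = (√(2 / (N : ℝ)))⁻¹ * (√(2 / (N : ℝ)))⁻¹ := by
    rw [← mul_inv, hs]
  have hsum : ∑ p : Fin N, ∑ q : Fin N, weight α ((p : ℤ) - (q : ℤ)) *
      (inner ℝ (cellVec N p) (toL2 φ) * inner ℝ (cellVec N q) (toL2 φ)) =
      (2 / (N : ℝ))⁻¹ * ∑ p : Fin N, ∑ q : Fin N, weight α ((p : ℤ) - (q : ℤ)) *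
        ((∫ x in cell (2 / N) ⁻¹' {(p : ℤ)}, (φ : ℝ → ℝ) x) *
          ∫ x in cell (2 / N) ⁻¹' {(q : ℤ)}, (φ : ℝ → ℝ) x) := by
    simp_rw [Finset.mul_sum, inner_cellVec_toL2]
    refine Finset.sum_congr rfl fun p _ => Finset.sum_congr rfl fun q _ => ?_
    rw [hsi]; ring
  rw [hn, hsum, Real.rpow_add hε, Real.rpow_one]
  have hp : (2 / (N : ℝ)) ^ α ≠ 0 := (Real.rpow_pos_of_pos hε α).ne'
  have hε' := hε.ne'
  generalize (2 / (N : ℝ)) ^ α = r at *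
  generalize (2 / (N : ℝ)) = ε at *
  field_simp

end

/-! ### Positivity of the weight matrix -/

section

/-- Triangle kernels are positive semidefinite: `(L - |p - q|)₊` is the number of windows of length
`L` that contain both `p` and `q`. -/
theorem sum_triangle_nonneg (N L : ℕ) (x : Fin N → ℝ) :
    0 ≤ ∑ p : Fin N, ∑ q : Fin N, ((L - ((p : ℤ) - (q : ℤ)).natAbs : ℕ) : ℝ) * (x p * x q) := by
  have hcount : ∀ p q : Fin N, ((L - ((p : ℤ) - (q : ℤ)).natAbs : ℕ) : ℝ) =
      ∑ j ∈ Finset.range (N + L),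
        (if (p : ℕ) ≤ j ∧ j < p + L then (1 : ℝ) else 0) *
          (if (q : ℕ) ≤ j ∧ j < q + L then 1 else 0) := by
    intro p q
    simp_rw [ite_zero_mul_ite_zero, mul_one]
    rw [Finset.sum_boole]
    congr 1
    have : Finset.filter (fun j => ((p : ℕ) ≤ j ∧ j < p + L) ∧ ((q : ℕ) ≤ j ∧ j < q + L))
        (Finset.range (N + L)) = Finset.Ico (max (p : ℕ) q) (min (p : ℕ) q + L) := by
      ext j
      have := p.2
      simp only [Finset.mem_filter, Finset.mem_range, Finset.mem_Ico]
      omega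
    rw [this, Nat.card_Ico]
    omega
  have : ∑ p : Fin N, ∑ q : Fin N, ((L - ((p : ℤ) - (q : ℤ)).natAbs : ℕ) : ℝ) * (x p * x q) =
      ∑ j ∈ Finset.range (N + L),
        (∑ p : Fin N, (if (p : ℕ) ≤ j ∧ j < p + L then x p else 0)) ^ 2 := by
    simp_rw [hcount, Finset.sum_mul]
    rw [Finset.sum_congr rfl fun p _ => Finset.sum_comm, Finset.sum_comm]
    refine Finset.sum_congr rfl fun j _ => ?_
    rw [sq, Finset.sum_mul_sum]
    refine Finset.sum_congr rfl fun p _ => Finset.sum_congr rfl fun q _ => ?_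
    split_ifs <;> simp
  rw [this]
  exact Finset.sum_nonneg fun j _ => sq_nonneg _

/-- A finite sequence is a combination of a constant and of triangle functions, the coefficients
being its last value, its last difference, and its second differences. -/
theorem eq_triangle_sum (a : ℕ → ℝ) (M : ℕ) {m : ℕ} (hm : m ≤ M) :
    a m = a M + (a M - a (M + 1)) * ((M - m : ℕ) : ℝ) +
      ∑ j ∈ Finset.range M, (a j - 2 * a (j + 1) + a (j + 2)) * ((j + 1 - m : ℕ) : ℝ) := by
  induction M with
  | zero =>
    obtain rfl : m = 0 := by omega
    simp
  | succ M ih =>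
    rcases Nat.lt_or_ge M m with h | h
    · obtain rfl : m = M + 1 := by omega
      rw [Finset.sum_eq_zero]
      · simp
      · intro j hj
        rw [Finset.mem_range] at hj
        rw [show j + 1 - (M + 1) = 0 by omega]
        simp
    · rw [Finset.sum_range_succ]
      have h1 : ((M + 1 - m : ℕ) : ℝ) = ((M - m : ℕ) : ℝ) + 1 := by
        rw [← Nat.cast_add_one]; congr 1; omega
      rw [h1]
      linear_combination ih h

/-- Pólya's criterion: a nonnegative, decreasing, convex sequence gives a positive semidefinite
Toeplitz matrix. -/
theorem sum_toeplitz_nonneg {a : ℕ → ℝ} (h0 : ∀ m, 0 ≤ a m) (h1 : ∀ m, a (m + 1) ≤ a m)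
    (h2 : ∀ m, 0 ≤ a m - 2 * a (m + 1) + a (m + 2)) (N : ℕ) (x : Fin N → ℝ) :
    0 ≤ ∑ p : Fin N, ∑ q : Fin N, a ((p : ℤ) - (q : ℤ)).natAbs * (x p * x q) := by
  have e : ∀ p q : Fin N, a ((p : ℤ) - (q : ℤ)).natAbs * (x p * x q) =
      a N * (x p * x q) +
      (a N - a (N + 1)) * (((N - ((p : ℤ) - (q : ℤ)).natAbs : ℕ) : ℝ) * (x p * x q)) +
      ∑ j ∈ Finset.range N, (a j - 2 * a (j + 1) + a (j + 2)) *
        (((j + 1 - ((p : ℤ) - (q : ℤ)).natAbs : ℕ) : ℝ) * (x p * x q)) := by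
    intro p q
    have := p.2
    have := q.2
    conv_lhs => rw [eq_triangle_sum a N (show ((p : ℤ) - (q : ℤ)).natAbs ≤ N by omega)]
    rw [add_mul, add_mul, Finset.sum_mul]
    simp only [mul_assoc]
  simp_rw [e, Finset.sum_add_distrib]
  refine add_nonneg (add_nonneg ?_ ?_) ?_
  · simp_rw [← Finset.mul_sum, ← Finset.sum_mul]
    exact mul_nonneg (h0 N) (mul_self_nonneg _)
  · simp_rw [← Finset.mul_sum]
    exact mul_nonneg (sub_nonneg.2 (h1 N)) (sum_triangle_nonneg N N x)
  · rw [Finset.sum_congr rfl fun p _ => Finset.sum_comm, Finset.sum_comm]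
    simp_rw [← Finset.mul_sum]
    exact Finset.sum_nonneg fun j _ => mul_nonneg (h2 j) (sum_triangle_nonneg N (j + 1) x)

variable {α : ℝ}

theorem sum_weight_nonneg (hα0 : 0 < α) (N : ℕ) (x : Fin N → ℝ) :
    0 ≤ ∑ p : Fin N, ∑ q : Fin N, weight α ((p : ℤ) - (q : ℤ)) * (x p * x q) := by
  have key := sum_toeplitz_nonneg (a := fun m : ℕ => ((m : ℝ) + 1) ^ (-(1 + α)))
    (fun m => by positivity)
    (fun m => Real.rpow_le_rpow_of_nonpos (by positivity) (by push_cast; linarith) (by linarith))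
    (fun m => by
      -- by the inequality of means it suffices to compare the product of the outer terms with the
      -- square of the middle one, that is, `(b - 1) (b + 1)` with `b ^ 2`
      set s := -(1 + α) with hs
      push_cast
      have huv : (((m : ℝ) + 1 + 1) ^ s) ^ 2 ≤ ((m : ℝ) + 1) ^ s * ((m : ℝ) + 2 + 1) ^ s := by
        rw [sq, ← Real.mul_rpow (by positivity) (by positivity),
          ← Real.mul_rpow (by positivity) (by positivity)]
        exact Real.rpow_le_rpow_of_nonpos (by positivity) (by nlinarith) (by linarith)
      have hu : 0 ≤ ((m : ℝ) + 1) ^ s := by positivity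
      have hv : 0 ≤ ((m : ℝ) + 2 + 1) ^ s := by positivity
      have := abs_le_of_sq_le_sq (a := 2 * ((m : ℝ) + 1 + 1) ^ s)
        (b := ((m : ℝ) + 1) ^ s + ((m : ℝ) + 2 + 1) ^ s)
        (by nlinarith [sq_nonneg (((m : ℝ) + 1) ^ s - ((m : ℝ) + 2 + 1) ^ s)]) (by positivity)
      linarith [(abs_le.1 this).2]) N x
  refine key.trans_eq (Finset.sum_congr rfl fun p _ => Finset.sum_congr rfl fun q _ => ?_)
  rw [weight, Real.rpow_neg (by positivity), one_div, Nat.cast_natAbs, Int.cast_abs]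

end

/-! ### The min-max argument -/

section

variable {α : ℝ}

open Matrix

theorem V_eq (α : ℝ) {N : ℕ} (p q : Fin N) :
    V α N p q = c α / (2 / (N : ℝ)) ^ α *
      ((2 * zetaOnePlus α - 1) * (if p = q then 1 else 0) - weight α ((p : ℤ) - (q : ℤ))) := by
  simp only [V, Matrix.of_apply]
  split_ifs with h
  · subst h; simp [weight]; ring
  · simp only [weight]; push_cast; ring

theorem dotProduct_V_mulVec (α : ℝ) {N : ℕ} (x : Fin N → ℝ) :
    x ⬝ᵥ (V α N *ᵥ x) = c α / (2 / (N : ℝ)) ^ α * ((2 * zetaOnePlus α - 1) * (x ⬝ᵥ x) -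
      ∑ p : Fin N, ∑ q : Fin N, weight α ((p : ℤ) - (q : ℤ)) * (x p * x q)) := by
  have : ∀ p, x p * x p = ∑ q, (if p = q then 1 else 0) * (x p * x q) := fun p => by simp
  simp only [dotProduct, mulVec, this, Finset.mul_sum, ← Finset.sum_sub_distrib, V_eq]
  refine Finset.sum_congr rfl fun p _ => Finset.sum_congr rfl fun q _ => ?_
  ring

section Spectral

variable {ι : Type*} [Fintype ι] [DecidableEq ι] {A : Matrix ι ι ℝ}

theorem sum_dotProduct_eigenvectorBasis_mul (hA : A.IsHermitian) (x y : ι → ℝ) :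
    ∑ i, (⇑(hA.eigenvectorBasis i) ⬝ᵥ x) * (⇑(hA.eigenvectorBasis i) ⬝ᵥ y) = x ⬝ᵥ y := by
  have := hA.eigenvectorBasis.sum_inner_mul_inner (WithLp.toLp 2 x) (WithLp.toLp 2 y)
  simp only [EuclideanSpace.inner_eq_star_dotProduct, star_trivial] at this
  rw [dotProduct_comm x y, ← this]
  refine Finset.sum_congr rfl fun i _ => ?_
  rw [dotProduct_comm _ y]

theorem dotProduct_mulVec_eq_sum_eigenvalues (hA : A.IsHermitian) (x : ι → ℝ) :
    x ⬝ᵥ (A *ᵥ x) = ∑ i, hA.eigenvalues i * (⇑(hA.eigenvectorBasis i) ⬝ᵥ x) ^ 2 := by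
  rw [← sum_dotProduct_eigenvectorBasis_mul hA]
  refine Finset.sum_congr rfl fun i _ => ?_
  have hT : Aᵀ = A := by simpa using hA.eq
  rw [dotProduct_mulVec, ← mulVec_transpose, hT, hA.mulVec_eigenvectorBasis, smul_dotProduct,
    smul_eq_mul]
  ring

theorem eigenvalues_le_of_dotProduct_mulVec_le (hA : A.IsHermitian) {M : ℝ}
    (h : ∀ x, x ⬝ᵥ (A *ᵥ x) ≤ M * (x ⬝ᵥ x)) (i : ι) : hA.eigenvalues i ≤ M := by
  have h1 : ⇑(hA.eigenvectorBasis i) ⬝ᵥ ⇑(hA.eigenvectorBasis i) = (1 : ℝ) := by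
    have := hA.eigenvectorBasis.inner_eq_one i
    rwa [EuclideanSpace.inner_eq_star_dotProduct, star_trivial] at this
  simpa [hA.mulVec_eigenvectorBasis, h1] using h (hA.eigenvectorBasis i)

end Spectral

/-- Fewer than `n` linear conditions leave a nonzero vector in the span of `n` independent ones. -/
theorem exists_sum_ne_zero_of_linearIndependent {E : Type*} [AddCommGroup E] [Module ℝ E]
    {m n : ℕ} (hmn : m < n) {φ : Fin n → E} (hφ : LinearIndependent ℝ φ)
    (l : Fin m → E →ₗ[ℝ] ℝ) :
    ∃ a : Fin n → ℝ, ∑ i, a i • φ i ≠ 0 ∧ ∀ j, l j (∑ i, a i • φ i) = 0 := by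
  have hker : (LinearMap.pi l ∘ₗ Fintype.linearCombination ℝ φ).ker ≠ ⊥ :=
    LinearMap.ker_ne_bot_of_finrank_lt (by simpa using hmn)
  obtain ⟨a, ha, ha0⟩ := Submodule.exists_mem_ne_zero_of_ne_bot hker
  refine ⟨a, fun h => ha0 ?_, fun j => congrFun (LinearMap.mem_ker.1 ha) j⟩
  ext i
  exact Fintype.linearIndependent_iff.1 hφ a h i

/-- The min-max principle for the discretized form, whose spectrum consists of the eigenvalues of
`V` and of the number `c_α ε^{-α} (2 ζ(1+α) - 1)`, which is not less than these eigenvalues. -/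
theorem lamEps_le_of_discreteForm_le (hα0 : 0 < α) {N n : ℕ} (hN : 0 < N) (hn : 1 ≤ n)
    {φ : Fin n → L2D} (hφ : LinearIndependent ℝ φ) {t : ℝ}
    (h : ∀ a : Fin n → ℝ, discreteForm α N (∑ i, a i • φ i) ≤ t * ‖∑ i, a i • φ i‖ ^ 2) :
    lamEps α N n ≤ t := by
  have hε : (0 : ℝ) < 2 / N := by positivity
  have hκ : 0 ≤ c α / (2 / (N : ℝ)) ^ α := div_nonneg (c_nonneg hα0) (by positivity)
  set M : ℝ := c α / (2 / (N : ℝ)) ^ α * (2 * zetaOnePlus α - 1) with hM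
  -- the coordinates of `f` with respect to the cells
  set x : L2D → Fin N → ℝ := fun f p => inner ℝ (cellVec N p) f with hx
  have hform : ∀ f, discreteForm α N f =
      M * (‖f‖ ^ 2 - x f ⬝ᵥ x f) + x f ⬝ᵥ (V α N *ᵥ x f) := fun f => by
    rw [dotProduct_V_mulVec, discreteForm, hM]; ring
  have hbessel : ∀ f, x f ⬝ᵥ x f ≤ ‖f‖ ^ 2 := fun f => by
    have := (orthonormal_cellVec hN).sum_inner_products_le (x := f) (s := Finset.univ)
    simpa [dotProduct, ← sq] using this
  rw [lamEps]
  split_ifs with hnN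
  · obtain ⟨-, hnN⟩ := hnN
    set hV := V_isHermitian α N
    set lam := hV.eigenvalues₀ ⟨N - n, by rw [Fintype.card_fin]; omega⟩
    let e : Fin N ≃ Fin (Fintype.card (Fin N)) :=
      (Fintype.equivOfCardEq (Fintype.card_fin _)).symm
    have heig : ∀ i, hV.eigenvalues i = hV.eigenvalues₀ (e i) := fun i => rfl
    -- annihilate the `n - 1` eigenvectors with smaller eigenvalues
    let idx : Fin (n - 1) → Fin N := fun j =>
      e.symm ⟨N - n + 1 + j, by rw [Fintype.card_fin]; have := j.2; omega⟩
    obtain ⟨a, ha0, ha⟩ := exists_sum_ne_zero_of_linearIndependent (m := n - 1) (by omega) hφ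
      fun j => ∑ p, hV.eigenvectorBasis (idx j) p • innerₗ L2D (cellVec N p)
    set f := ∑ i, a i • φ i
    have hle : lam ≤ M := by
      have : lam = hV.eigenvalues (e.symm ⟨N - n, by rw [Fintype.card_fin]; omega⟩) := by
        rw [heig, Equiv.apply_symm_apply]
      rw [this]
      refine eigenvalues_le_of_dotProduct_mulVec_le hV (fun y => ?_) _
      rw [dotProduct_V_mulVec, hM, mul_assoc]
      exact mul_le_mul_of_nonneg_left (sub_le_self _ (sum_weight_nonneg hα0 N y)) hκ
    have hVx : lam * (x f ⬝ᵥ x f) ≤ x f ⬝ᵥ (V α N *ᵥ x f) := by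
      rw [dotProduct_mulVec_eq_sum_eigenvalues hV,
        ← sum_dotProduct_eigenvectorBasis_mul hV, Finset.mul_sum]
      refine Finset.sum_le_sum fun i _ => ?_
      rw [← sq]
      rcases Nat.lt_or_ge (N - n) (e i) with hi | hi
      · have hiN : (e i : ℕ) < N := by simpa using (e i).2
        have hidx : idx ⟨e i - (N - n + 1), by omega⟩ = i := by
          rw [Equiv.symm_apply_eq]
          ext
          simp only
          omega
        have h0 := ha ⟨e i - (N - n + 1), by omega⟩
        rw [hidx] at h0
        have : ⇑(hV.eigenvectorBasis i) ⬝ᵥ x f = 0 := by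
          simpa [dotProduct, hx] using h0
        rw [this]; simp
      · exact mul_le_mul_of_nonneg_right
          (by rw [heig]; exact hV.eigenvalues₀_antitone (Fin.le_def.2 hi)) (sq_nonneg _)
    have key := h a
    rw [hform] at key
    have hfpos : 0 < ‖f‖ ^ 2 := by positivity
    have := mul_le_mul_of_nonneg_right hle (sub_nonneg.2 (hbessel f))
    nlinarith
  · obtain ⟨a, ha0, ha⟩ := exists_sum_ne_zero_of_linearIndependent (m := N) (by omega) hφ
      fun p => innerₗ L2D (cellVec N p)
    set f := ∑ i, a i • φ i
    have hx0 : x f = 0 := funext ha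
    have key := h a
    rw [hform, hx0] at key
    have hfpos : 0 < ‖f‖ ^ 2 := by positivity
    rw [Real.rpow_neg hε.le, ← div_eq_mul_inv, ← hM]
    exact le_of_mul_le_mul_right (by simpa using key) hfpos

end

end FracInterval

theorem mainTheorem5 (α : ℝ) (hα0 : 0 < α) (hα2 : α < 2) (N : ℕ) (hN : 0 < N)
    (n : ℕ) (hn : 1 ≤ n) :
    ((FracInterval.lamEps α N n : ℝ) : EReal) ≤ FracInterval.lam α n := by
  refine le_sInf ?_
  rintro _ ⟨t, ⟨φ, μ, hφ, hμ⟩, rfl⟩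
  refine EReal.coe_le_coe_iff.2
    (FracInterval.lamEps_le_of_discreteForm_le hα0 hN hn hφ fun a => ?_)
  have hsymm := FracInterval.form_lapL2_isSymm hα0 hα2
  have hmem := fun i => (hμ i).1.mem_friedrichs hα0 hα2
  have hsum := Submodule.sum_mem _ fun i (_ : i ∈ Finset.univ) =>
    Submodule.smul_mem _ (a i) (hmem i)
  refine le_trans ?_ (FracInterval.inner_sum_eigenvectors_le hsymm
    (FracInterval.form_lapL2_nonneg hα0 hα2) hmem (fun i => (hμ i).2) a)
  refine FracInterval.le_inner_of_mem_friedrichs hsymm (FracInterval.form_lapL2_nonneg hα0 hα2)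
    (FracInterval.continuous_discreteForm α N)
    (FracInterval.discreteForm_toL2_le hα0 hα2 hN) ?_
  rwa [show ∑ i, a i • (φ i, μ i • φ i) = (∑ i, a i • φ i, ∑ i, a i • μ i • φ i) from
    Prod.ext (by simp [Prod.fst_sum]) (by simp [Prod.snd_sum])] at hsum
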